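/- Let $G=\widetilde{\mathrm{PSL}}(2,\mathbb{R})$ be the universal covering group of $\mathrm{PSL}(2,\mathbb{R})$, acting on the hyperbolic plane $\mathbb{H}^2$ by isometries through the covering projection $\theta: G\to \mathrm{PSL}(2,\mathbb{R})$ and Möbius transformations, and let $L(P)=\inf_{z\in\mathbb{H}^2} d_{\mathbb{H}^2}(z,Pz)$ be the translation length of $P\in G$. Let $\{X^t\}_{t\in\mathbb{R}}$ be the one-parameter subgroup of $G$ with $\theta(X^t)=\pm\begin{pmatrix} e^{t/2}&0\\0&e^{-t/2}\end{pmatrix}$. Let $\Gamma\subset G$ be a cocompact lattice (a discrete subgroup such that $M_\Gamma=\Gamma\backslash G$ is compact). Identify $\Gamma$ with $\pi_1(M_\Gamma)$, so that a class $a\in H^1(M_\Gamma,\mathbb{R})$ is a homomorphism $\Gamma\to\mathbb{R}$, $\gamma\mapsto a(\gamma)$, and let $\Delta_\Gamma$ be the set of all $a\in H^1(M_\Gamma,\mathbb{R})$ such that $$\sup\left\{\frac{|a(\gamma)|}{L(\gamma)} \;\middle|\; \gamma\in\Gamma,\ L(\gamma)\neq 0\right\}<1.$$ Then, for every $a\in\Delta_\Gamma$,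 the left action $\Gamma_a(\gamma,P)=\gamma P X^{a(\gamma)}$ of $\Gamma$ on $G$ is free (if $\Gamma_a(\gamma,P)=P$ for some $P\in G$, then $\gamma=1$) and properly discontinuous (for all compact $K,K'\subset G$, the set of $\gamma\in\Gamma$ with $\Gamma_a(\gamma,K)\cap K'\neq\emptyset$ is finite). -/

import Mathlib

open scoped MatrixGroups UpperHalfPlane unitInterval

noncomputable section

section UniversalCover

variable (H : Type*) [Group H] [TopologicalSpace H] [IsTopologicalGroup H]

/-- The group (under pointwise multiplication) of continuous paths `[0,1] → H` that start at the
identity, with the compact-open topology inherited from `C([0,1], H)`. -/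
def BasedPaths : Subgroup C(I, H) where
  carrier := {f | f 0 = 1}
  mul_mem' {f g} hf hg := by
    have h1 : f 0 = 1 := hf
    have h2 : g 0 = 1 := hg
    simp [h1, h2]
  one_mem' := by simp
  inv_mem' {f} hf := by
    have h1 : f 0 = 1 := hf
    simp [h1]

instance pathGroup.isTopologicalGroup : IsTopologicalGroup C(I, H) where
  continuous_inv :=
    ContinuousMap.continuous_postcomp (⟨fun x => x⁻¹, continuous_inv⟩ : C(H, H))

variable {H}

/-- Homotopies relative to a set can be multiplied pointwise. -/
theorem homotopicRel_mul {S : Set I} {f f' g g' : C(I, H)}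
    (hf : f.HomotopicRel f' S) (hg : g.HomotopicRel g' S) :
    (f * g).HomotopicRel (f' * g') S := by
  obtain ⟨F⟩ := hf
  obtain ⟨G⟩ := hg
  refine ⟨⟨⟨⟨fun x => F x * G x, by fun_prop⟩, ?_, ?_⟩, ?_⟩⟩
  · intro x; simp
  · intro x; simp
  · intro t x hx
    have h1 := F.prop' t x hx
    have h2 := G.prop' t x hx
    simp only [ContinuousMap.mul_apply]
    exact congrArg₂ (· * ·) h1 h2

/-- Homotopies relative to a set can be inverted pointwise. -/
theorem homotopicRel_inv {S : Set I} {f f' : C(I, H)} (hf : f.HomotopicRel f' S) :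
    (f⁻¹).HomotopicRel (f'⁻¹) S := by
  obtain ⟨F⟩ := hf
  refine ⟨⟨⟨⟨fun x => (F x)⁻¹, by fun_prop⟩, ?_, ?_⟩, ?_⟩⟩
  · intro x; simp
  · intro x; simp
  · intro t x hx
    have h1 := F.prop' t x hx
    simp only [ContinuousMap.inv_apply]
    exact congrArg (·⁻¹) h1

variable (H)

/-- The subgroup of the loops at the identity that are homotopic, with fixed end points, to the
constant loop. -/
def NullLoops : Subgroup (BasedPaths H) where
  carrier := {f | (f : C(I, H)).HomotopicRel 1 {0, 1}}
  mul_mem' {f g} hf hg := by simpa using! homotopicRel_mul hf hg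
  one_mem' := ContinuousMap.HomotopicRel.refl _
  inv_mem' {f} hf := by simpa using! homotopicRel_inv hf

instance NullLoops.normal : (NullLoops H).Normal where
  conj_mem n hn g := by
    have h := homotopicRel_mul
      (homotopicRel_mul (ContinuousMap.HomotopicRel.refl (S := {0, 1}) (g : C(I, H))) hn)
      (ContinuousMap.HomotopicRel.refl (S := {0, 1}) (g : C(I, H))⁻¹)
    simpa using! h

/-- The universal covering group of a (connected, locally path-connected, semi-locally simply
connected) topological group `H`, in the standard construction: the set of homotopy classes with
fixed end points of paths in `H` that start at the identity, with pointwise multiplication and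
with the quotient of the compact-open topology.
It carries Mathlib's group structure and topology on a quotient group. -/
abbrev UniversalCover : Type _ := BasedPaths H ⧸ NullLoops H

variable {H}

/-- Two based paths are the same point of the universal cover exactly if they are homotopic with
fixed end points. -/
theorem UniversalCover.mk_eq_mk_iff (f g : BasedPaths H) :
    (QuotientGroup.mk f : UniversalCover H) = QuotientGroup.mk g ↔
      (f : C(I, H)).HomotopicRel (g : C(I, H)) {0, 1} := by
  rw [QuotientGroup.eq]
  constructor
  · intro h
    have h2 := homotopicRel_mul
      (ContinuousMap.HomotopicRel.refl (S := {0, 1}) (f : C(I, H))) h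
    exact ContinuousMap.HomotopicRel.symm (by simpa using! h2)
  · intro h
    have h2 := homotopicRel_mul
      (ContinuousMap.HomotopicRel.refl (S := {0, 1}) (f : C(I, H))⁻¹) h
    exact ContinuousMap.HomotopicRel.symm (by simpa using! h2)

variable (H)

/-- The covering projection: it sends the class of a path to its end point. -/
def UniversalCover.proj : UniversalCover H →* H :=
  QuotientGroup.lift (NullLoops H)
    { toFun := fun f => (f : C(I, H)) 1
      map_one' := rfl
      map_mul' := fun _ _ => rfl }
    (fun f hf => by
      have h : (f : C(I, H)).HomotopicRel 1 {0, 1} := hf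
      exact h.fst_eq_snd (x := 1) (by simp))

theorem UniversalCover.continuous_proj : Continuous (UniversalCover.proj H) := by
  refine (QuotientGroup.isQuotientMap_mk (NullLoops H)).continuous_iff.2 ?_
  change Continuous fun f : BasedPaths H => (f : C(I, H)) 1
  fun_prop

theorem UniversalCover.isTopologicalGroup : IsTopologicalGroup (UniversalCover H) :=
  inferInstance

end UniversalCover

/-- The universal covering group of `PSL(2, ℝ)`. -/
abbrev PSLTilde : Type := UniversalCover PSL(2, ℝ)

/-- The projection `θ` from the universal covering group to `PSL(2, ℝ)`. -/
abbrev theta : PSLTilde →* PSL(2, ℝ) := UniversalCover.proj PSL(2, ℝ)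

/-- The matrix `diag(e^{t/2}, e^{-t/2})`. -/
def diagSL (t : ℝ) : SL(2, ℝ) :=
  ⟨!![Real.exp (t / 2), 0; 0, Real.exp (-(t / 2))], by
    simp [Matrix.det_fin_two, ← Real.exp_add]⟩

theorem diagSL_add (s t : ℝ) : diagSL (s + t) = diagSL s * diagSL t := by
  ext i j
  rw [Matrix.SpecialLinearGroup.coe_mul]
  fin_cases i <;> fin_cases j <;>
    simp [diagSL, ← Real.exp_add] <;> ring_nf

theorem diagSL_zero : diagSL 0 = 1 := by
  ext i j
  fin_cases i <;> fin_cases j <;> simp [diagSL]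

theorem continuous_diagSL : Continuous diagSL := by
  refine Continuous.subtype_mk ?_ _
  refine continuous_matrix fun i j => ?_
  fin_cases i <;> fin_cases j <;> simp <;> fun_prop

/-- The path `s ↦ ± diag(e^{st/2}, e^{-st/2})` in `PSL(2, ℝ)`, for `0 ≤ s ≤ 1`. -/
def diagPath (t : ℝ) : BasedPaths PSL(2, ℝ) :=
  ⟨⟨fun s => (QuotientGroup.mk (diagSL ((s : ℝ) * t)) : PSL(2, ℝ)),
    continuous_quotient_mk'.comp (continuous_diagSL.comp (by fun_prop))⟩, by
    change (QuotientGroup.mk (diagSL (((0 : I) : ℝ) * t)) : PSL(2, ℝ)) = 1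
    simp [diagSL_zero]⟩

theorem diagPath_add (s t : ℝ) : diagPath (s + t) = diagPath s * diagPath t := by
  apply Subtype.ext
  ext u
  change (QuotientGroup.mk (diagSL ((u : ℝ) * (s + t))) : PSL(2, ℝ)) =
    QuotientGroup.mk (diagSL ((u : ℝ) * s)) * QuotientGroup.mk (diagSL ((u : ℝ) * t))
  rw [mul_add, diagSL_add, QuotientGroup.mk_mul]

/-- The one-parameter subgroup `X^t` of the universal covering group of `PSL(2, ℝ)`: the lift of
the one-parameter subgroup `t ↦ ± diag(e^{t/2}, e^{-t/2})`. -/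
def XOne (t : ℝ) : PSLTilde := QuotientGroup.mk (diagPath t)

theorem XOne_add (s t : ℝ) : XOne (s + t) = XOne s * XOne t := by
  rw [XOne, diagPath_add]; rfl

theorem XOne_zero : XOne 0 = 1 := by
  have h := XOne_add 0 0
  rw [add_zero] at h
  exact (left_eq_mul.mp h)

theorem theta_XOne (t : ℝ) : theta (XOne t) = QuotientGroup.mk (diagSL t) := by
  change (QuotientGroup.mk (diagSL (((1 : I) : ℝ) * t)) : PSL(2, ℝ)) = _
  simp

/-- The action of `PSL(2, ℝ)` on the upper half-plane by Möbius transformations, as a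
homomorphism to the permutations of `ℍ`. -/
def moebius : PSL(2, ℝ) →* Equiv.Perm ℍ :=
  QuotientGroup.lift (Subgroup.center SL(2, ℝ)) (MulAction.toPermHom SL(2, ℝ) ℍ) (fun g hg => by
    obtain ⟨r, hr, hrg⟩ := Matrix.SpecialLinearGroup.mem_center_iff.mp hg
    have hr0 : r ≠ 0 := by rintro rfl; simp at hr
    ext z
    have h00 : g 0 0 = r := by simp [← hrg]
    have h01 : g 0 1 = 0 := by simp [← hrg]
    have h10 : g 1 0 = 0 := by simp [← hrg]
    have h11 : g 1 1 = r := by simp [← hrg]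
    simp [UpperHalfPlane.specialLinearGroup_apply, h00, h01, h10, h11, hr0])

/-- The translation length `L(P) = inf_{z ∈ ℍ} d(z, P z)` of an element of the universal covering
group of `PSL(2, ℝ)` acting on the hyperbolic plane. -/
def translationLength (P : PSLTilde) : ℝ :=
  ⨅ z : ℍ, dist z (moebius (theta P) z)

/-- A cocompact lattice: a discrete subgroup `Γ` such that the space `Γ \ G` of the cosets `Γ g`
is compact. -/
structure IsCocompactLattice {G : Type*} [Group G] [TopologicalSpace G] (Γ : Subgroup G) :
    Prop where
  discrete : DiscreteTopology Γ
  cocompact : CompactSpace (Quotient (QuotientGroup.rightRel Γ))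

/-- First real cohomology classes of `M_Γ = Γ \ G`, given by their evaluations on
`Γ = π₁(M_Γ)`: `H¹(M_Γ, ℝ) = Hom(π₁(M_Γ), ℝ) = Hom(Γ, ℝ)`. -/
abbrev H1Class (Γ : Subgroup PSLTilde) : Type := Additive Γ →+ ℝ

/-- The evaluation `a(γ)` of a class `a` at `γ ∈ Γ`. -/
def H1Class.eval {Γ : Subgroup PSLTilde} (a : H1Class Γ) (γ : Γ) : ℝ := a (Additive.ofMul γ)

/-- The set `Δ_Γ` of the classes `a` such that the supremum of `|a(γ)| / L(γ)` over all `γ ∈ Γ`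
with `L(γ) ≠ 0` is less than one. The supremum is taken in the extended reals. -/
def DeltaSet (Γ : Subgroup PSLTilde) : Set (H1Class Γ) :=
  {a | sSup {x : EReal | ∃ γ : Γ, translationLength (γ : PSLTilde) ≠ 0 ∧
    x = ((|a.eval γ| / translationLength (γ : PSLTilde) : ℝ) : EReal)} < 1}

/-- The left action `Γ_a (γ, P) = γ P X^{a(γ)}` of `Γ` on the universal covering group. -/
abbrev twistedAction {Γ : Subgroup PSLTilde} (a : H1Class Γ) : MulAction Γ PSLTilde where
  smul γ P := (γ : PSLTilde) * P * XOne (a.eval γ)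
  one_smul P := by
    change ((1 : Γ) : PSLTilde) * P * XOne (a (Additive.ofMul (1 : Γ))) = P
    rw [ofMul_one, map_zero, XOne_zero]
    simp
  mul_smul γ δ P := by
    change ((γ * δ : Γ) : PSLTilde) * P * XOne (a (Additive.ofMul (γ * δ))) =
      (γ : PSLTilde) * ((δ : PSLTilde) * P * XOne (a (Additive.ofMul δ))) *
        XOne (a (Additive.ofMul γ))
    rw [ofMul_mul, map_add, add_comm, XOne_add]
    simp [mul_assoc]

/-- An action is free if only the identity has a fixed point. -/
def IsFreeAction {G : Type*} {T : Type*} [Group G] (A : MulAction G T) : Prop :=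
  ∀ (g : G) (x : T), A.smul g x = x → g = 1

/-- An action is properly discontinuous if, for any compact sets `K` and `L`, only finitely many
`g` satisfy `g K ∩ L ≠ ∅`. -/
def IsProperlyDiscontinuousAction {G : Type*} {T : Type*} [Group G] [TopologicalSpace T]
    (A : MulAction G T) : Prop :=
  @ProperlyDiscontinuousSMul G T _ A.toSMul

end

/-!
Write `L` for the translation length and fix `c < 1` with `|a(γ)| ≤ c L(γ)` whenever `L(γ) > 0`.

Freeness. If `γ P X^{a(γ)} = P`, then `γ` is conjugate to `X^{-a(γ)}`. If `a(γ) ≠ 0` this gives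
`0 < L(γ) ≤ |a(γ)|`, against `|a(γ)| ≤ c L(γ)`; hence `a(γ) = 0` and `γ = 1`.

Proper discontinuity. If `γ K X^{a(γ)}` meets `K'`, then `γ = k' X^t k⁻¹` with `t = -a(γ)`, `k ∈ K`
and `k' ∈ K'`. A discrete group meets a compact set in a finite set (`finite_inter_of_discrete`),
so it suffices to bound `|t|`; replacing `γ` by its inverse, only `t > 0` matters. For hyperbolic
`γ` the triangle inequality gives `L(γ) ≤ t + D` with `D` depending on `K` and `K'`, so
`t ≤ c (t + D)` and `t` is bounded. In general `γ` is first multiplied by an element `δ` of the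
lattice that makes it hyperbolic, which changes `a(γ)` by a constant only
(`exists_eventually_neg_eval_le`). The trace of `γ δ` is that of `X^t k⁻¹ δ k'`, and it is large for
large `t` as soon as the upper left entry of `k⁻¹ δ k'` does not vanish; near a given pair `(k, k')`
one such `δ` serves, and compactness does the rest.

Such a `δ` exists because a cocompact lattice has no common fixed point at infinity
(`exists_not_upper_triangular`). Suppose it were conjugate into the upper triangular group. If all
its elements were unipotent up to sign, the norm of the second row would be an unbounded continuous
function on the compact quotient. Otherwise it contains a hyperbolic element, and conjugating by
its powers contracts unipotent commutators to the identity; by discreteness these commutators are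
trivial (`unipotent_part_eq_zero`), so that the lattice is diagonal, and now the product of the
norms of the two rows is an unbounded continuous function on the compact quotient. These
computations take place in `PSL(2, ℝ)`, up to elements of the kernel of `theta`; the kernel is
central (`UniversalCover.commute_of_proj_eq_one`), which is all that is needed about it.
-/

noncomputable section

open Filter Topology

/-! ### Entries of elements of `PSL(2, ℝ)` -/

theorem PSL.mk_eq_mk_iff (A B : SL(2, ℝ)) :
    (QuotientGroup.mk A : PSL(2, ℝ)) = QuotientGroup.mk B ↔ B = A ∨ B = -A := by
  rw [QuotientGroup.eq, Matrix.SpecialLinearGroup.mem_center_iff]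
  constructor
  · rintro ⟨r, hr, h⟩
    have hB : (B : Matrix (Fin 2) (Fin 2) ℝ) = A * Matrix.scalar (Fin 2) r := by
      rw [h, ← Matrix.SpecialLinearGroup.coe_mul, mul_inv_cancel_left]
    rcases (by simpa using hr : r = 1 ∨ r = -1) with rfl | rfl
    · left; ext i j; simp [hB]
    · right; ext i j; simp [hB]
  · rintro (rfl | rfl)
    · exact ⟨1, by simp, by simp⟩
    · exact ⟨-1, by simp, by ext i j; fin_cases i <;> fin_cases j <;> simp⟩

/-- The absolute value of the `(i, j)` entry of an element of `PSL(2, ℝ)`. -/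
def absEntry (i j : Fin 2) : PSL(2, ℝ) → ℝ :=
  Quotient.lift (fun A : SL(2, ℝ) => |A i j|) (by
    intro A B h
    have h' : (QuotientGroup.mk A : PSL(2, ℝ)) = QuotientGroup.mk B := Quotient.sound h
    rcases (PSL.mk_eq_mk_iff A B).mp h' with rfl | rfl <;> simp)

theorem absEntry_mk (i j : Fin 2) (A : SL(2, ℝ)) :
    absEntry i j (QuotientGroup.mk A : PSL(2, ℝ)) = |A i j| := rfl

theorem SL2.mul_apply (A B : SL(2, ℝ)) (i j : Fin 2) :
    (A * B) i j = A i 0 * B 0 j + A i 1 * B 1 j := by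
  rw [Matrix.SpecialLinearGroup.coe_mul, Matrix.mul_apply, Fin.sum_univ_two]

theorem absEntry_mk_mul (i j : Fin 2) (A B : SL(2, ℝ)) :
    absEntry i j ((QuotientGroup.mk A : PSL(2, ℝ)) * QuotientGroup.mk B) =
      |A i 0 * B 0 j + A i 1 * B 1 j| := by
  rw [← QuotientGroup.mk_mul, absEntry_mk, SL2.mul_apply]

@[fun_prop]
theorem continuous_absEntry (i j : Fin 2) : Continuous (absEntry i j) := by
  refine Continuous.quotient_lift ?_ _
  have h : Continuous fun A : SL(2, ℝ) => (A : Matrix (Fin 2) (Fin 2) ℝ) i j :=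
    (continuous_subtype_val : Continuous fun A : SL(2, ℝ) => A.1).matrix_elem i j
  exact h.abs

/-- The upper triangular matrix with ones on the diagonal and `x` above it. -/
def unipSL (x : ℝ) : SL(2, ℝ) := ⟨!![1, x; 0, 1], by simp [Matrix.det_fin_two]⟩

theorem coe_unipSL (x : ℝ) : (unipSL x : Matrix (Fin 2) (Fin 2) ℝ) = !![1, x; 0, 1] := rfl

theorem coe_diagSL (t : ℝ) : (diagSL t : Matrix (Fin 2) (Fin 2) ℝ) =
    !![Real.exp (t / 2), 0; 0, Real.exp (-(t / 2))] := rfl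

theorem unipSL_add (x y : ℝ) : unipSL (x + y) = unipSL x * unipSL y := by
  ext i j
  rw [Matrix.SpecialLinearGroup.coe_mul]
  fin_cases i <;> fin_cases j <;> simp [unipSL, add_comm]

theorem unipSL_zero : unipSL 0 = 1 := by
  ext i j
  fin_cases i <;> fin_cases j <;> simp [unipSL]

theorem continuous_unipSL : Continuous unipSL := by
  refine Continuous.subtype_mk ?_ _
  refine continuous_matrix fun i j => ?_
  fin_cases i <;> fin_cases j <;> simp <;> fun_prop

theorem diagSL_mul_unipSL (t x : ℝ) :
    diagSL t * unipSL x = unipSL (Real.exp t * x) * diagSL t := by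
  ext i j
  have h : Real.exp (t / 2) = Real.exp t * Real.exp (-(t / 2)) := by
    rw [← Real.exp_add]; ring_nf
  rw [Matrix.SpecialLinearGroup.coe_mul, Matrix.SpecialLinearGroup.coe_mul]
  fin_cases i <;> fin_cases j <;> simp [unipSL, diagSL]
  rw [h]; ring

/-- An upper triangular element of `PSL(2, ℝ)` is the product of a unipotent and a diagonal
element: the representative with positive diagonal has this form. -/
theorem PSL.exists_unipSL_mul_diagSL (q : PSL(2, ℝ)) (hq : absEntry 1 0 q = 0) :
    ∃ x s : ℝ, q = QuotientGroup.mk (unipSL x * diagSL s) := by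
  have key : ∀ A : SL(2, ℝ), A 1 0 = 0 → 0 < A 0 0 →
      A = unipSL (A 0 1 * A 0 0) * diagSL (2 * Real.log (A 0 0)) := by
    intro A h10 hpos
    have hdet : A 0 0 * A 1 1 = 1 := by
      have := A.det_coe
      rw [Matrix.det_fin_two, h10] at this
      linarith
    have h11 : A 1 1 = (A 0 0)⁻¹ := eq_inv_of_mul_eq_one_right hdet
    ext i j
    rw [Matrix.SpecialLinearGroup.coe_mul]
    fin_cases i <;> fin_cases j <;>
      simp [unipSL, diagSL, h10, h11, Real.exp_neg, Real.exp_log hpos, hpos.ne']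
  obtain ⟨A, rfl⟩ := QuotientGroup.mk_surjective q
  have h10 : A 1 0 = 0 := by simpa [absEntry_mk] using hq
  have h00 : A 0 0 ≠ 0 := by
    intro h
    have := A.det_coe
    rw [Matrix.det_fin_two, h10, h] at this
    simp at this
  rcases lt_or_gt_of_ne h00 with h | h
  · have hA : (QuotientGroup.mk A : PSL(2, ℝ)) = QuotientGroup.mk (-A) :=
      (PSL.mk_eq_mk_iff _ _).mpr (Or.inr rfl)
    exact ⟨_, _, hA.trans (congrArg _ (key (-A) (by simp [h10]) (by simpa using h)))⟩
  · exact ⟨_, _, congrArg _ (key A h10 h)⟩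

/-! ### The universal covering group -/

section

variable {H : Type*} [Group H] [TopologicalSpace H] [IsTopologicalGroup H]

/-- The kernel of the covering projection is central: for a loop `f` and a path `g`, conjugating
`f` by the initial pieces `t ↦ g (s t)` of `g` is a homotopy from `f` to `g f g⁻¹`. -/
theorem UniversalCover.commute_of_proj_eq_one (z P : UniversalCover H)
    (hz : UniversalCover.proj H z = 1) : Commute z P := by
  obtain ⟨f, rfl⟩ := QuotientGroup.mk_surjective z
  obtain ⟨g, rfl⟩ := QuotientGroup.mk_surjective P
  have hf1 : (f : C(I, H)) 1 = 1 := hz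
  have hf0 : (f : C(I, H)) 0 = 1 := f.2
  have hg0 : (g : C(I, H)) 0 = 1 := g.2
  suffices h : (QuotientGroup.mk f : UniversalCover H) = QuotientGroup.mk (g * f * g⁻¹) by
    have h' : (QuotientGroup.mk f : UniversalCover H) =
        QuotientGroup.mk g * QuotientGroup.mk f * (QuotientGroup.mk g)⁻¹ := h
    exact (mul_inv_eq_iff_eq_mul.mp h'.symm).symm
  rw [UniversalCover.mk_eq_mk_iff]
  refine ⟨⟨⟨⟨fun p => (g : C(I, H)) (p.1 * p.2) * (f : C(I, H)) p.2 *
    ((g : C(I, H)) (p.1 * p.2))⁻¹, by fun_prop⟩, ?_, ?_⟩, ?_⟩⟩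
  · intro x; simp [hg0]
  · intro x; simp
  · rintro t x (rfl | rfl)
    · simp [hf0]
    · simp [hf1]

end

/-- The path `s ↦ ± unipSL (s x)` in `PSL(2, ℝ)`, for `0 ≤ s ≤ 1`. -/
def unipPath (x : ℝ) : BasedPaths PSL(2, ℝ) :=
  ⟨⟨fun s => (QuotientGroup.mk (unipSL ((s : ℝ) * x)) : PSL(2, ℝ)),
    continuous_quotient_mk'.comp (continuous_unipSL.comp (by fun_prop))⟩, by
    change (QuotientGroup.mk (unipSL (((0 : I) : ℝ) * x)) : PSL(2, ℝ)) = 1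
    simp [unipSL_zero]⟩

/-- The one-parameter subgroup of the universal covering group of `PSL(2, ℝ)` that lifts
`x ↦ ± unipSL x`. -/
def UOne (x : ℝ) : PSLTilde := QuotientGroup.mk (unipPath x)

theorem UOne_add (x y : ℝ) : UOne (x + y) = UOne x * UOne y := by
  have h : unipPath (x + y) = unipPath x * unipPath y := by
    apply Subtype.ext
    ext u
    change (QuotientGroup.mk (unipSL ((u : ℝ) * (x + y))) : PSL(2, ℝ)) =
      QuotientGroup.mk (unipSL ((u : ℝ) * x)) * QuotientGroup.mk (unipSL ((u : ℝ) * y))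
    rw [mul_add, unipSL_add, QuotientGroup.mk_mul]
  rw [UOne, h]; rfl

theorem UOne_zero : UOne 0 = 1 := by
  have h := UOne_add 0 0
  rw [add_zero] at h
  exact (left_eq_mul.mp h)

theorem UOne_neg (x : ℝ) : UOne (-x) = (UOne x)⁻¹ := by
  rw [eq_inv_iff_mul_eq_one, ← UOne_add, neg_add_cancel, UOne_zero]

theorem XOne_neg (t : ℝ) : XOne (-t) = (XOne t)⁻¹ := by
  rw [eq_inv_iff_mul_eq_one, ← XOne_add, neg_add_cancel, XOne_zero]

theorem theta_UOne (x : ℝ) : theta (UOne x) = QuotientGroup.mk (unipSL x) := by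
  change (QuotientGroup.mk (unipSL (((1 : I) : ℝ) * x)) : PSL(2, ℝ)) = _
  simp

theorem continuous_XOne : Continuous XOne := by
  refine continuous_quotient_mk'.comp (Continuous.subtype_mk ?_ _)
  refine ContinuousMap.continuous_of_continuous_uncurry _ ?_
  exact continuous_quotient_mk'.comp (continuous_diagSL.comp (by fun_prop))

theorem continuous_UOne : Continuous UOne := by
  refine continuous_quotient_mk'.comp (Continuous.subtype_mk ?_ _)
  refine ContinuousMap.continuous_of_continuous_uncurry _ ?_
  exact continuous_quotient_mk'.comp (continuous_unipSL.comp (by fun_prop))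

/-- The relation `X^t U^x = U^{e^t x} X^t` lifts from `PSL(2, ℝ)`: at time `s` the two paths are
`± unipSL (e^{st} s x) diagSL (s t)` and `± unipSL (s e^t x) diagSL (s t)`, and interpolating
linearly between the two unipotent parameters is a homotopy. -/
theorem XOne_mul_UOne (t x : ℝ) : XOne t * UOne x = UOne (Real.exp t * x) * XOne t := by
  change (QuotientGroup.mk (diagPath t * unipPath x) : PSLTilde) =
    QuotientGroup.mk (unipPath (Real.exp t * x) * diagPath t)
  rw [UniversalCover.mk_eq_mk_iff]
  refine ⟨⟨⟨⟨fun p => (QuotientGroup.mk (unipSL ((1 - (p.1 : ℝ)) *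
    (Real.exp ((p.2 : ℝ) * t) * ((p.2 : ℝ) * x)) + (p.1 : ℝ) * ((p.2 : ℝ) * (Real.exp t * x))) *
    diagSL ((p.2 : ℝ) * t)) : PSL(2, ℝ)), ?_⟩, ?_, ?_⟩, ?_⟩⟩
  · exact continuous_quotient_mk'.comp
      ((continuous_unipSL.comp (by fun_prop)).mul (continuous_diagSL.comp (by fun_prop)))
  · intro s
    change _ = (QuotientGroup.mk (diagSL ((s : ℝ) * t) * unipSL ((s : ℝ) * x)) : PSL(2, ℝ))
    simp [diagSL_mul_unipSL]
  · intro s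
    change _ = (QuotientGroup.mk
      (unipSL ((s : ℝ) * (Real.exp t * x)) * diagSL ((s : ℝ) * t)) : PSL(2, ℝ))
    simp
  · intro u s hs
    change _ = (QuotientGroup.mk (diagSL ((s : ℝ) * t) * unipSL ((s : ℝ) * x)) : PSL(2, ℝ))
    rw [diagSL_mul_unipSL]
    rcases hs with rfl | rfl
    · simp
    · simp [← add_mul]

/-- An element of the universal covering group with upper triangular image is a product of a
central element, a unipotent element and a diagonal element. -/
theorem exists_eq_mul_UOne_mul_XOne (P : PSLTilde) (hP : absEntry 1 0 (theta P) = 0) :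
    ∃ (z : PSLTilde) (x s : ℝ), theta z = 1 ∧ P = z * (UOne x * XOne s) := by
  obtain ⟨x, s, h⟩ := PSL.exists_unipSL_mul_diagSL _ hP
  refine ⟨P * (UOne x * XOne s)⁻¹, x, s, ?_, (inv_mul_cancel_right _ _).symm⟩
  rw [map_mul, map_inv, map_mul, theta_UOne, theta_XOne, h, ← QuotientGroup.mk_mul,
    mul_inv_cancel]

/-! ### A cocompact lattice has no fixed point at infinity -/

theorem absEntry_unipSL (x : ℝ) :
    absEntry 0 1 (QuotientGroup.mk (unipSL x) : PSL(2, ℝ)) = |x| := by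
  simp [absEntry_mk, coe_unipSL]

theorem UOne_eq_one_iff (x : ℝ) : UOne x = 1 ↔ x = 0 := by
  refine ⟨fun h => ?_, fun h => by rw [h, UOne_zero]⟩
  have h1 := congrArg (fun P => absEntry 0 1 (theta P)) h
  simp only [theta_UOne, absEntry_unipSL, map_one] at h1
  rw [← QuotientGroup.mk_one, absEntry_mk] at h1
  simpa using h1

theorem absEntry_one_zero_conj_UOne (q : PSL(2, ℝ)) (x : ℝ) (hq : absEntry 1 0 q = 0) :
    absEntry 1 0 ((QuotientGroup.mk (unipSL x))⁻¹ * q * QuotientGroup.mk (unipSL x)) = 0 := by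
  obtain ⟨A, rfl⟩ := QuotientGroup.mk_surjective q
  rw [absEntry_mk, abs_eq_zero] at hq
  have hinv : (unipSL x)⁻¹ = unipSL (-x) := by
    rw [inv_eq_iff_mul_eq_one, ← unipSL_add, add_neg_cancel, unipSL_zero]
  rw [← QuotientGroup.mk_inv, hinv, ← QuotientGroup.mk_mul, absEntry_mk_mul, SL2.mul_apply,
    SL2.mul_apply]
  simp [coe_unipSL, hq]

theorem IsCocompactLattice.exists_bound {G : Type*} [Group G] [TopologicalSpace G]
    {Γ : Subgroup G} (hΓ : IsCocompactLattice Γ) {f : G → ℝ} (hf : Continuous f)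
    (hinv : ∀ γ ∈ Γ, ∀ P, f (γ * P) = f P) : ∃ C, ∀ P, f P ≤ C := by
  have := hΓ.cocompact
  let F : Quotient (QuotientGroup.rightRel Γ) → ℝ := Quotient.lift f (by
    intro P Q h
    have h' : Q * P⁻¹ ∈ Γ := QuotientGroup.rightRel_apply.mp h
    have := hinv _ h' P
    rw [inv_mul_cancel_right] at this
    exact this.symm)
  have hF : Continuous F := hf.quotient_lift _
  obtain ⟨C, hC⟩ := (isCompact_range hF).bddAbove
  exact ⟨C, fun P => hC ⟨Quotient.mk _ P, rfl⟩⟩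

/-- A discrete subgroup meets a neighbourhood of the identity only in the identity. -/
theorem eventually_eq_one_of_discrete {G : Type*} [Group G] [TopologicalSpace G]
    {Γ : Subgroup G} (hΓ : DiscreteTopology Γ) : ∀ᶠ g in 𝓝 (1 : G), g ∈ Γ → g = 1 := by
  have h : ({1} : Set Γ) ∈ 𝓝 (1 : Γ) := mem_nhds_discrete.mpr rfl
  rw [nhds_subtype_eq_comap] at h
  obtain ⟨t, ht, hts⟩ := h
  filter_upwards [ht] with g hg hgΓ
  exact congrArg Subtype.val (hts (show (⟨g, hgΓ⟩ : Γ) ∈ _ from hg) : (⟨g, hgΓ⟩ : Γ) = 1)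

/-- A discrete subgroup has finite intersection with every compact set; the group need not be
Hausdorff. -/
theorem finite_inter_of_discrete {G : Type*} [Group G] [TopologicalSpace G] [IsTopologicalGroup G]
    {Γ : Subgroup G} (hΓ : DiscreteTopology Γ) {K : Set G} (hK : IsCompact K) :
    ((Γ : Set G) ∩ K).Finite := by
  refine hK.induction_on (p := fun s => ((Γ : Set G) ∩ s).Finite) (by simp)
    (fun s t hst ht => ht.subset (Set.inter_subset_inter_right _ hst))
    (fun s t hs ht => by rw [Set.inter_union_distrib_left]; exact hs.union ht) ?_
  intro x _
  have hdiv : Tendsto (fun p : G × G => p.1⁻¹ * p.2) (𝓝 x ×ˢ 𝓝 x) (𝓝 1) := by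
    have h : Continuous fun p : G × G => p.1⁻¹ * p.2 := by fun_prop
    simpa [nhds_prod_eq] using h.tendsto (x, x)
  obtain ⟨W, hW, hWW⟩ :=
    mem_prod_same_iff.mp (hdiv.eventually (eventually_eq_one_of_discrete hΓ))
  refine ⟨W, mem_nhdsWithin_of_mem_nhds hW, Set.Subsingleton.finite ?_⟩
  rintro g ⟨hg, hgW⟩ h ⟨hh, hhW⟩
  exact inv_mul_eq_one.mp (hWW (Set.mk_mem_prod hgW hhW) (Γ.mul_mem (Γ.inv_mem hg) hh))

section

variable {Γ : Subgroup PSLTilde}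

/-- If a discrete group contains a conjugate `g z₀ X^{s₀} g⁻¹` with `s₀ < 0`, then any other element
that fixes its repelling fixed point `g ∞` also fixes its attracting fixed point `g 0`: conjugates
of the commutator by powers of the given element converge to the identity, so the commutator is
trivial. -/
theorem unipotent_part_eq_zero (hΓ : DiscreteTopology Γ) {g δ₀ δ z₀ z : PSLTilde} {s₀ x s : ℝ}
    (hδ₀ : δ₀ ∈ Γ) (hδ : δ ∈ Γ) (hz₀ : theta z₀ = 1) (hz : theta z = 1) (hs₀ : s₀ < 0)
    (h₀ : g⁻¹ * δ₀ * g = z₀ * XOne s₀) (h : g⁻¹ * δ * g = z * (UOne x * XOne s)) : x = 0 := by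
  have hz₀c := fun P => UniversalCover.commute_of_proj_eq_one z₀ P hz₀
  have hzc := fun P => UniversalCover.commute_of_proj_eq_one z P hz
  -- conjugation by `X^t` scales the unipotent parameter
  have hconj : ∀ t y, XOne t * UOne y * (XOne t)⁻¹ = UOne (Real.exp t * y) := fun t y => by
    rw [XOne_mul_UOne, mul_inv_cancel_right]
  have hlt : Real.exp s₀ < 1 := by simpa using hs₀
  have hcomm : XOne s₀ * XOne s = XOne s * XOne s₀ := by
    rw [← XOne_add, ← XOne_add, add_comm]
  have h₀' : δ₀ = g * (z₀ * XOne s₀) * g⁻¹ := by rw [← h₀]; group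
  have h' : δ = g * (z * (UOne x * XOne s)) * g⁻¹ := by rw [← h]; group
  set y : ℝ := (Real.exp s₀ - 1) * x with hy
  have hcom : δ₀ * δ * δ₀⁻¹ * δ⁻¹ = g * UOne y * g⁻¹ := by
    have e1 : δ₀ * δ * δ₀⁻¹ * δ⁻¹ = g * ((z₀ * (XOne s₀ * (z * (UOne x * XOne s)) *
        (XOne s₀)⁻¹)) * z₀⁻¹ * (z * (UOne x * XOne s))⁻¹) * g⁻¹ := by
      rw [h₀', h']; group
    have e2 : XOne s₀ * (z * (UOne x * XOne s)) * (XOne s₀)⁻¹ =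
        z * (UOne (Real.exp s₀ * x) * XOne s) := by
      rw [← mul_assoc, ← (hzc (XOne s₀)).eq, mul_assoc z, ← mul_assoc (XOne s₀),
        XOne_mul_UOne, mul_assoc (UOne _), hcomm]
      group
    have e3 : UOne y = UOne (Real.exp s₀ * x) * (UOne x)⁻¹ := by
      rw [← UOne_neg, ← UOne_add, hy]; ring_nf
    rw [e1, e2, (hz₀c _).eq, mul_inv_cancel_right, e3, mul_inv_rev, mul_inv_rev]
    have e4 : z * (UOne (Real.exp s₀ * x) * XOne s) * ((XOne s)⁻¹ * (UOne x)⁻¹ * z⁻¹) =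
        z * (UOne (Real.exp s₀ * x) * (UOne x)⁻¹) * z⁻¹ := by group
    rw [e4, (hzc _).eq, mul_inv_cancel_right]
  have hn : ∀ n : ℕ, δ₀ ^ n * (δ₀ * δ * δ₀⁻¹ * δ⁻¹) * (δ₀ ^ n)⁻¹ =
      g * UOne (Real.exp s₀ ^ n * y) * g⁻¹ := by
    intro n
    induction n with
    | zero => rw [pow_zero, pow_zero, one_mul, one_mul, inv_one, mul_one, hcom]
    | succ n ih =>
      have e1 : δ₀ ^ (n + 1) * (δ₀ * δ * δ₀⁻¹ * δ⁻¹) * (δ₀ ^ (n + 1))⁻¹ =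
          δ₀ * (δ₀ ^ n * (δ₀ * δ * δ₀⁻¹ * δ⁻¹) * (δ₀ ^ n)⁻¹) * δ₀⁻¹ := by
        rw [pow_succ']; group
      have e2 : g * (z₀ * XOne s₀) * g⁻¹ * (g * UOne (Real.exp s₀ ^ n * y) * g⁻¹) *
          (g * (z₀ * XOne s₀) * g⁻¹)⁻¹ =
          g * (z₀ * (XOne s₀ * UOne (Real.exp s₀ ^ n * y) * (XOne s₀)⁻¹) * z₀⁻¹) * g⁻¹ := by
        group
      rw [e1, ih, h₀', e2, hconj, (hz₀c _).eq, mul_inv_cancel_right, pow_succ' (Real.exp s₀),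
        mul_assoc (Real.exp s₀)]
  have hlim : Tendsto (fun n : ℕ => g * UOne (Real.exp s₀ ^ n * y) * g⁻¹) atTop (𝓝 1) := by
    have h1 : Tendsto (fun n : ℕ => Real.exp s₀ ^ n * y) atTop (𝓝 (0 * y)) :=
      (tendsto_pow_atTop_nhds_zero_of_lt_one (Real.exp_pos _).le
        hlt).mul_const y
    have h2 : Continuous fun r : ℝ => g * UOne r * g⁻¹ := by
      have := continuous_UOne
      fun_prop
    have h3 := (h2.tendsto (0 * y)).comp h1
    simpa [UOne_zero, Function.comp_def] using h3
  obtain ⟨n, hn1⟩ := (hlim.eventually (eventually_eq_one_of_discrete hΓ)).exists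
  have hmem : g * UOne (Real.exp s₀ ^ n * y) * g⁻¹ ∈ Γ := by
    rw [← hn]
    exact Γ.mul_mem (Γ.mul_mem (Γ.pow_mem hδ₀ _) (Γ.mul_mem (Γ.mul_mem (Γ.mul_mem hδ₀ hδ)
      (Γ.inv_mem hδ₀)) (Γ.inv_mem hδ))) (Γ.inv_mem (Γ.pow_mem hδ₀ _))
  have hone : UOne (Real.exp s₀ ^ n * y) = 1 := by
    have := hn1 hmem
    rwa [mul_inv_eq_one, mul_eq_left] at this
  rw [UOne_eq_one_iff, hy] at hone
  have he : Real.exp s₀ - 1 ≠ 0 := (sub_neg.mpr hlt).ne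
  simpa [he, Real.exp_ne_zero] using hone

/-- In a cocompact lattice with a common fixed point `g ∞` at infinity, some element is not
unipotent up to sign: otherwise the squared norm of the second row of `g⁻¹ P` would be a continuous
invariant function of `P`, but it is unbounded. -/
theorem exists_absEntry_one_one_ne_one (hΓ : IsCocompactLattice Γ) (g : PSLTilde)
    (hupper : ∀ δ ∈ Γ, absEntry 1 0 (theta (g⁻¹ * δ * g)) = 0) :
    ∃ δ ∈ Γ, absEntry 1 1 (theta (g⁻¹ * δ * g)) ≠ 1 := by
  by_contra! hone
  have hθ : Continuous theta := UniversalCover.continuous_proj _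
  obtain ⟨C, hC⟩ := hΓ.exists_bound
    (f := fun P => absEntry 1 0 (theta (g⁻¹ * P)) ^ 2 + absEntry 1 1 (theta (g⁻¹ * P)) ^ 2)
    (by fun_prop) (by
      intro γ hγ P
      have h0 := hupper γ hγ
      have h1 := hone γ hγ
      have e : g⁻¹ * (γ * P) = (g⁻¹ * γ * g) * (g⁻¹ * P) := by group
      rw [e, map_mul]
      generalize theta (g⁻¹ * γ * g) = q at h0 h1
      generalize theta (g⁻¹ * P) = p
      obtain ⟨A, rfl⟩ := QuotientGroup.mk_surjective q
      obtain ⟨B, rfl⟩ := QuotientGroup.mk_surjective p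
      rw [absEntry_mk, abs_eq_zero] at h0
      rw [absEntry_mk] at h1
      simp only [absEntry_mk_mul, absEntry_mk, h0, zero_mul, zero_add, abs_mul, h1, one_mul])
  -- the function takes the value `e^{-t}` at `g X^t`
  have h := hC (g * XOne (-(C + 1)))
  rw [inv_mul_cancel_left, theta_XOne, absEntry_mk, absEntry_mk] at h
  simp only [coe_diagSL, Matrix.of_apply, Matrix.cons_val', Matrix.cons_val_zero, Matrix.cons_val_one,
    Matrix.cons_val_fin_one, abs_zero, sq_abs, ← Real.exp_nat_mul] at h
  have := Real.add_one_le_exp (C + 1)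
  have e : ((2 : ℕ) : ℝ) * -(-(C + 1) / 2) = C + 1 := by push_cast; ring
  rw [e] at h
  norm_num at h
  linarith

/-- The image of a cocompact lattice in `PSL(2, ℝ)` is not conjugate to a group of diagonal
matrices: the product of the squared norms of the rows would be an invariant function. -/
theorem exists_not_diagonal (hΓ : IsCocompactLattice Γ) (g : PSLTilde) :
    ∃ δ ∈ Γ, ¬ ∃ s : ℝ, theta (g⁻¹ * δ * g) = QuotientGroup.mk (diagSL s) := by
  by_contra! hdiag
  have hθ : Continuous theta := UniversalCover.continuous_proj _
  obtain ⟨C, hC⟩ := hΓ.exists_bound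
    (f := fun P =>
      (absEntry 0 0 (theta (g⁻¹ * P)) ^ 2 + absEntry 0 1 (theta (g⁻¹ * P)) ^ 2) *
      (absEntry 1 0 (theta (g⁻¹ * P)) ^ 2 + absEntry 1 1 (theta (g⁻¹ * P)) ^ 2))
    (by fun_prop) (by
      intro γ hγ P
      obtain ⟨s, hs⟩ := hdiag γ hγ
      have e : g⁻¹ * (γ * P) = (g⁻¹ * γ * g) * (g⁻¹ * P) := by group
      rw [e, map_mul, hs]
      generalize theta (g⁻¹ * P) = p
      obtain ⟨B, rfl⟩ := QuotientGroup.mk_surjective p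
      have h1 : Real.exp (s / 2) * Real.exp (-(s / 2)) = 1 := by rw [← Real.exp_add]; simp
      simp only [absEntry_mk_mul, absEntry_mk, sq_abs, coe_diagSL,
        Matrix.of_apply, Matrix.cons_val', Matrix.cons_val_zero,
        Matrix.cons_val_one, Matrix.cons_val_fin_one, zero_mul, add_zero, zero_add]
      calc _ = (Real.exp (s / 2) * Real.exp (-(s / 2))) ^ 2 *
            (((B 0 0) ^ 2 + (B 0 1) ^ 2) * ((B 1 0) ^ 2 + (B 1 1) ^ 2)) := by ring
        _ = _ := by rw [h1]; ring)
  -- the function takes the value `1 + x ^ 2` at `g U^x`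
  have h := hC (g * UOne C)
  rw [inv_mul_cancel_left, theta_UOne] at h
  simp [absEntry_mk, coe_unipSL] at h
  nlinarith [sq_nonneg (C - 1 / 2)]

/-- The image of a cocompact lattice in `PSL(2, ℝ)` has no common fixed point at infinity, that is,
it is not conjugate to a group of upper triangular matrices. -/
theorem exists_not_upper_triangular (hΓ : IsCocompactLattice Γ) (g : PSLTilde) :
    ∃ δ ∈ Γ, absEntry 1 0 (theta (g⁻¹ * δ * g)) ≠ 0 := by
  by_contra! hupper
  obtain ⟨δ₁, hδ₁, hne⟩ := exists_absEntry_one_one_ne_one hΓ g hupper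
  obtain ⟨z₁, x₁, s₁, hz₁, h₁⟩ := exists_eq_mul_UOne_mul_XOne _ (hupper δ₁ hδ₁)
  have hs₁ : s₁ ≠ 0 := by
    rintro rfl
    apply hne
    rw [h₁, map_mul, hz₁, one_mul, XOne_zero, mul_one, theta_UOne]
    simp [absEntry_mk, coe_unipSL]
  have hexp : 1 - Real.exp s₁ ≠ 0 := by
    rw [sub_ne_zero, ne_comm, Ne, Real.exp_eq_one_iff]
    exact hs₁
  -- conjugating by `U^r` moves the second fixed point of `δ₁` to `0`
  set r : ℝ := x₁ / (1 - Real.exp s₁) with hr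
  set g' : PSLTilde := g * UOne r with hg'
  have hconj : ∀ δ, g'⁻¹ * δ * g' = (UOne r)⁻¹ * (g⁻¹ * δ * g) * UOne r := fun δ => by
    rw [hg']; group
  have hdiag₁ : g'⁻¹ * δ₁ * g' = z₁ * XOne s₁ := by
    have hzc := UniversalCover.commute_of_proj_eq_one z₁ (UOne r)⁻¹ hz₁
    rw [hconj, h₁, ← mul_assoc (UOne r)⁻¹, ← hzc.eq, mul_assoc, mul_assoc, mul_assoc,
      XOne_mul_UOne, ← mul_assoc (UOne x₁), ← mul_assoc (UOne r)⁻¹, ← UOne_add, ← UOne_neg,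
      ← UOne_add]
    have : -r + (x₁ + Real.exp s₁ * r) = 0 := by
      rw [hr]; field_simp; ring
    rw [this, UOne_zero, one_mul]
  obtain ⟨δ₀, hδ₀, z₀, s₀, hz₀, hs₀, hdiag⟩ : ∃ δ₀ ∈ Γ, ∃ (z₀ : PSLTilde) (s₀ : ℝ),
      theta z₀ = 1 ∧ s₀ < 0 ∧ g'⁻¹ * δ₀ * g' = z₀ * XOne s₀ := by
    rcases lt_or_gt_of_ne hs₁ with h | h
    · exact ⟨δ₁, hδ₁, z₁, s₁, hz₁, h, hdiag₁⟩
    · refine ⟨δ₁⁻¹, Γ.inv_mem hδ₁, z₁⁻¹, -s₁, by rw [map_inv, hz₁, inv_one], by linarith, ?_⟩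
      have e : g'⁻¹ * δ₁⁻¹ * g' = (g'⁻¹ * δ₁ * g')⁻¹ := by group
      have hzc := UniversalCover.commute_of_proj_eq_one z₁ (XOne s₁) hz₁
      rw [e, hdiag₁, XOne_neg, hzc.eq, mul_inv_rev]
  obtain ⟨δ, hδ, hnd⟩ := exists_not_diagonal hΓ g'
  have hup : absEntry 1 0 (theta (g'⁻¹ * δ * g')) = 0 := by
    rw [hconj, map_mul, map_mul, map_inv, theta_UOne]
    exact absEntry_one_zero_conj_UOne _ _ (hupper δ hδ)
  obtain ⟨z, x, s, hz, h⟩ := exists_eq_mul_UOne_mul_XOne _ hup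
  have hx : x = 0 := unipotent_part_eq_zero hΓ.discrete hδ₀ hδ hz₀ hz hs₀ hdiag h
  refine hnd ⟨s, ?_⟩
  rw [h, hx, UOne_zero, one_mul, map_mul, hz, one_mul, theta_XOne]

end

/-! ### Translation lengths -/

theorem moebius_mk (A : SL(2, ℝ)) (z : ℍ) : moebius (QuotientGroup.mk A) z = A • z := rfl

theorem dist_moebius (q : PSL(2, ℝ)) (z w : ℍ) :
    dist (moebius q z) (moebius q w) = dist z w := by
  obtain ⟨A, rfl⟩ := QuotientGroup.mk_surjective q
  exact dist_smul A z w

theorem dist_moebius_mul_le (q r : PSL(2, ℝ)) (z : ℍ) :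
    dist z (moebius (q * r) z) ≤ dist z (moebius q z) + dist z (moebius r z) := by
  rw [map_mul, Equiv.Perm.mul_apply]
  refine (dist_triangle _ (moebius q z) _).trans ?_
  rw [dist_moebius]

theorem continuous_dist_moebius (z : ℍ) : Continuous fun q => dist z (moebius q z) := by
  have h : Continuous fun A : SL(2, ℝ) => dist z (A • z) := by fun_prop
  exact (QuotientGroup.isQuotientMap_mk _).continuous_iff.mpr h

theorem translationLength_le (P : PSLTilde) (z : ℍ) :
    translationLength P ≤ dist z (moebius (theta P) z) :=
  ciInf_le ⟨0, by rintro _ ⟨w, rfl⟩; exact dist_nonneg⟩ z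

theorem dist_I_diagSL_smul (t : ℝ) : dist UpperHalfPlane.I (diagSL t • UpperHalfPlane.I) = |t| := by
  have h : ((diagSL t • UpperHalfPlane.I : ℍ) : ℂ) = (Real.exp t : ℂ) * Complex.I := by
    have e : Real.exp t = Real.exp (t / 2) / Real.exp (-(t / 2)) := by
      rw [← Real.exp_sub]; ring_nf
    rw [UpperHalfPlane.coe_specialLinearGroup_apply, e]
    simp [coe_diagSL]
    ring
  have hre : (diagSL t • UpperHalfPlane.I : ℍ).re = 0 := by
    rw [← UpperHalfPlane.coe_re, h]; simp [-Complex.ofReal_exp]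
  have him : (diagSL t • UpperHalfPlane.I : ℍ).im = Real.exp t := by
    rw [← UpperHalfPlane.coe_im, h]; simp [-Complex.ofReal_exp]
  rw [UpperHalfPlane.dist_of_re_eq (by rw [hre]; simp), him]
  simp

/-- The displacement of the base point `I` is determined by the norm of the matrix. -/
theorem cosh_dist_I_smul (A : SL(2, ℝ)) : Real.cosh (dist UpperHalfPlane.I (A • UpperHalfPlane.I)) =
    (A 0 0 ^ 2 + A 0 1 ^ 2 + A 1 0 ^ 2 + A 1 1 ^ 2) / 2 := by
  have hdet : A 0 0 * A 1 1 - A 0 1 * A 1 0 = 1 := by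
    rw [← Matrix.det_fin_two, A.det_coe]
  have hpos : 0 < A 1 0 ^ 2 + A 1 1 ^ 2 := by
    by_contra! h
    have h0 : A 1 0 = 0 := by nlinarith [sq_nonneg (A 1 0), sq_nonneg (A 1 1)]
    have h1 : A 1 1 = 0 := by nlinarith [sq_nonneg (A 1 0), sq_nonneg (A 1 1)]
    rw [h0, h1] at hdet
    simp at hdet
  have hne : ((A 1 0 : ℂ) * Complex.I + A 1 1) ≠ 0 := by
    intro h
    have h0 : A 1 0 = 0 := by simpa using congrArg Complex.im h
    have h1 : A 1 1 = 0 := by simpa using congrArg Complex.re h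
    rw [h0, h1] at hpos
    simp at hpos
  -- `p + q i` is the image of the base point
  obtain ⟨p, hp⟩ : ∃ p, p = (A 0 0 * A 1 0 + A 0 1 * A 1 1) / (A 1 0 ^ 2 + A 1 1 ^ 2) := ⟨_, rfl⟩
  obtain ⟨q, hq⟩ : ∃ q, q = 1 / (A 1 0 ^ 2 + A 1 1 ^ 2) := ⟨_, rfl⟩
  have hb : A 0 1 = p * A 1 1 - q * A 1 0 := by
    rw [hp, hq]
    field_simp
    linear_combination (-A 1 0) * hdet
  have ha : A 0 0 = p * A 1 0 + q * A 1 1 := by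
    rw [hp, hq]
    field_simp
    linear_combination (A 1 1) * hdet
  have h : ((A • UpperHalfPlane.I : ℍ) : ℂ) = (p : ℂ) + (q : ℂ) * Complex.I := by
    rw [UpperHalfPlane.coe_specialLinearGroup_apply]
    simp only [Algebra.algebraMap_self, RingHom.id_apply, UpperHalfPlane.coe_I]
    rw [div_eq_iff hne, ha, hb]
    apply Complex.ext
    · simp
    · simp
  have hre : (A • UpperHalfPlane.I : ℍ).re = p := by
    rw [← UpperHalfPlane.coe_re, h]; simp
  have him : (A • UpperHalfPlane.I : ℍ).im = q := by
    rw [← UpperHalfPlane.coe_im, h]; simp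
  rw [UpperHalfPlane.cosh_dist', hre, him, hp, hq]
  simp only [UpperHalfPlane.I_re, UpperHalfPlane.I_im]
  field_simp
  linear_combination (-(A 0 0 * A 1 1 - A 0 1 * A 1 0) - 1) * hdet

/-- The squared trace bounds every displacement from below: by transitivity it is enough to consider
the base point, where the difference is half the square of `A 0 1 - A 1 0`. -/
theorem le_cosh_dist_smul (A : SL(2, ℝ)) (z : ℍ) :
    (A 0 0 + A 1 1) ^ 2 / 2 - 1 ≤ Real.cosh (dist z (A • z)) := by
  obtain ⟨B, rfl⟩ := MulAction.exists_smul_eq SL(2, ℝ) UpperHalfPlane.I z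
  have htr : (B⁻¹ * A * B) 0 0 + (B⁻¹ * A * B) 1 1 = A 0 0 + A 1 1 := by
    have h : (B⁻¹ * A * B : SL(2, ℝ)).1.trace = A.1.trace := by
      have e : B * (B⁻¹ * A) = A := mul_inv_cancel_left _ _
      rw [Matrix.SpecialLinearGroup.coe_mul, Matrix.trace_mul_comm,
        ← Matrix.SpecialLinearGroup.coe_mul, e]
    simpa [Matrix.trace_fin_two] using h
  have hd : dist (B • UpperHalfPlane.I) (A • B • UpperHalfPlane.I) =
      dist UpperHalfPlane.I ((B⁻¹ * A * B) • UpperHalfPlane.I) := by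
    rw [← dist_smul B UpperHalfPlane.I, smul_smul, smul_smul]
    group
  have hdet : (B⁻¹ * A * B) 0 0 * (B⁻¹ * A * B) 1 1 -
      (B⁻¹ * A * B) 0 1 * (B⁻¹ * A * B) 1 0 = 1 := by
    rw [← Matrix.det_fin_two, Matrix.SpecialLinearGroup.det_coe]
  rw [hd, cosh_dist_I_smul, ← htr]
  nlinarith [sq_nonneg ((B⁻¹ * A * B) 0 1 - (B⁻¹ * A * B) 1 0)]

/-- An element whose trace exceeds `2` in absolute value is hyperbolic. -/
theorem translationLength_pos {P : PSLTilde} {A : SL(2, ℝ)} (hP : theta P = QuotientGroup.mk A)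
    (hA : 2 < |A 0 0 + A 1 1|) : 0 < translationLength P := by
  set m : ℝ := (A 0 0 + A 1 1) ^ 2 / 2 - 1 with hm
  have hm1 : 1 < m := by
    rw [hm, ← sq_abs]
    nlinarith
  refine (Real.arcosh_pos hm1).trans_le (le_ciInf fun z => ?_)
  rw [hP, moebius_mk]
  rw [← Real.arcosh_cosh (dist_nonneg (x := z) (y := A • z)),
    Real.arcosh_le_arcosh (by linarith) (Real.cosh_pos _)]
  exact le_cosh_dist_smul A z

theorem translationLength_conj (P Q : PSLTilde) :
    translationLength (Q * P * Q⁻¹) = translationLength P := by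
  refine (Equiv.iInf_congr (moebius (theta Q)) fun z => ?_).symm
  have e : moebius (theta (Q * P * Q⁻¹)) (moebius (theta Q) z) =
      moebius (theta Q) (moebius (theta P) z) := by
    rw [← Equiv.Perm.mul_apply, ← map_mul, ← map_mul, inv_mul_cancel_right, map_mul, map_mul,
      Equiv.Perm.mul_apply]
  rw [e, dist_moebius]

theorem dist_I_XOne (t : ℝ) :
    dist UpperHalfPlane.I (moebius (theta (XOne t)) UpperHalfPlane.I) = |t| := by
  rw [theta_XOne, moebius_mk, dist_I_diagSL_smul]

theorem translationLength_XOne_pos {t : ℝ} (ht : t ≠ 0) : 0 < translationLength (XOne t) := by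
  refine translationLength_pos (theta_XOne t) ?_
  have h : Real.exp (t / 2) + Real.exp (-(t / 2)) = 2 * Real.cosh (t / 2) := by
    rw [Real.cosh_eq]; ring
  have h1 : 1 < Real.cosh (t / 2) := Real.one_lt_cosh.mpr (by simpa using ht)
  simp only [coe_diagSL, Matrix.of_apply, Matrix.cons_val', Matrix.cons_val_zero,
    Matrix.cons_val_one, Matrix.cons_val_fin_one]
  rw [h, abs_of_pos (by linarith)]
  linarith

/-! ### Boundedness of the class on the elements that move compact sets to compact sets -/

section

variable {Γ : Subgroup PSLTilde}

theorem H1Class.eval_mul (a : H1Class Γ) (γ δ : Γ) : a.eval (γ * δ) = a.eval γ + a.eval δ := by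
  rw [H1Class.eval, ofMul_mul, map_add]; rfl

theorem H1Class.eval_inv (a : H1Class Γ) (γ : Γ) : a.eval γ⁻¹ = -a.eval γ := by
  rw [H1Class.eval, ofMul_inv, map_neg]; rfl

theorem exists_le_mul_translationLength {a : H1Class Γ} (ha : a ∈ DeltaSet Γ) :
    ∃ c : ℝ, 0 ≤ c ∧ c < 1 ∧ ∀ γ : Γ, 0 < translationLength (γ : PSLTilde) →
      |a.eval γ| ≤ c * translationLength (γ : PSLTilde) := by
  obtain ⟨c, hc, hc1⟩ := EReal.lt_iff_exists_real_btwn.mp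
    (show sSup {x : EReal | ∃ γ : Γ, translationLength (γ : PSLTilde) ≠ 0 ∧
      x = ((|a.eval γ| / translationLength (γ : PSLTilde) : ℝ) : EReal)} < 1 from ha)
  refine ⟨max c 0, le_max_right _ _, max_lt (by exact_mod_cast hc1) one_pos, fun γ hγ => ?_⟩
  have h := (le_sSup (show _ ∈ {x : EReal | ∃ γ : Γ, translationLength (γ : PSLTilde) ≠ 0 ∧
    x = ((|a.eval γ| / translationLength (γ : PSLTilde) : ℝ) : EReal)} from
    ⟨γ, hγ.ne', rfl⟩)).trans_lt hc
  have h' : |a.eval γ| / translationLength (γ : PSLTilde) < c := by exact_mod_cast h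
  exact ((div_lt_iff₀ hγ).mp h').le.trans (mul_le_mul_of_nonneg_right (le_max_left _ _) hγ.le)

/-- For all `k` and `k'`, some element of the lattice does not move the line spanned by the first
column of `k'` to the line spanned by the second column of `k`. -/
theorem exists_absEntry_zero_zero_ne_zero (hΓ : IsCocompactLattice Γ) (k k' : PSLTilde) :
    ∃ δ ∈ Γ, absEntry 0 0 (theta (k⁻¹ * δ * k')) ≠ 0 := by
  by_contra! h
  obtain ⟨δ, hδ, hne⟩ := exists_not_upper_triangular hΓ k'
  apply hne
  have h1 := h 1 Γ.one_mem
  have hδ' := h δ hδ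
  have e : k⁻¹ * δ * k' = (k⁻¹ * 1 * k') * (k'⁻¹ * δ * k') := by group
  rw [e, map_mul] at hδ'
  generalize theta (k⁻¹ * 1 * k') = q at h1 hδ'
  generalize theta (k'⁻¹ * δ * k') = r at hδ'
  obtain ⟨A, rfl⟩ := QuotientGroup.mk_surjective q
  obtain ⟨B, rfl⟩ := QuotientGroup.mk_surjective r
  rw [absEntry_mk, abs_eq_zero] at h1
  rw [absEntry_mk_mul, h1, zero_mul, zero_add, abs_eq_zero, mul_eq_zero] at hδ'
  rw [absEntry_mk, abs_eq_zero]
  refine hδ'.resolve_left fun h0 => ?_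
  have := A.det_coe
  rw [Matrix.det_fin_two, h1, h0] at this
  simp at this

/-- Either `X^t B` is hyperbolic, or `t` is bounded in terms of the diagonal entries of `B`. -/
theorem translationLength_XOne_mul_pos {Q : PSLTilde} {t ε M : ℝ} (ht : 0 ≤ t) (hε : 0 < ε)
    (h0 : ε ≤ absEntry 0 0 (theta Q)) (h1 : absEntry 1 1 (theta Q) ≤ M)
    (hlt : 2 * ((2 + M) / ε) < t) : 0 < translationLength (XOne t * Q) := by
  obtain ⟨B, hB⟩ := QuotientGroup.mk_surjective (theta Q)
  rw [← hB, absEntry_mk] at h0 h1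
  refine translationLength_pos (A := diagSL t * B)
    (by rw [map_mul, theta_XOne, ← hB, QuotientGroup.mk_mul]) ?_
  have htr : (diagSL t * B) 0 0 + (diagSL t * B) 1 1 =
      Real.exp (t / 2) * B 0 0 + Real.exp (-(t / 2)) * B 1 1 := by
    rw [SL2.mul_apply, SL2.mul_apply]
    simp [coe_diagSL]
  have hexp : (2 + M) / ε < Real.exp (t / 2) := by
    have := Real.add_one_le_exp (t / 2)
    linarith
  have hbig : 2 + M < Real.exp (t / 2) * |B 0 0| :=
    ((div_lt_iff₀ hε).mp hexp).trans_le (mul_le_mul_of_nonneg_left h0 (Real.exp_pos _).le)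
  have hsmall : Real.exp (-(t / 2)) * |B 1 1| ≤ M := by
    have : Real.exp (-(t / 2)) ≤ 1 := Real.exp_le_one_iff.mpr (by linarith)
    exact (mul_le_of_le_one_left (abs_nonneg _) this).trans h1
  have htri := abs_sub_abs_le_abs_add (Real.exp (t / 2) * B 0 0) (Real.exp (-(t / 2)) * B 1 1)
  rw [abs_mul, abs_mul, Real.abs_exp, Real.abs_exp] at htri
  rw [htr]
  linarith

/-- The local form of the bound. If `γ = k' X^t k⁻¹` with `t = -a(γ)` large, then `γ δ` is
hyperbolic for a suitable `δ`, so that `|a(γ δ)| ≤ c L(γ δ) ≤ c (t + D)` with `c < 1`; since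
`a(γ δ)` differs from `-t` by the constant `a(δ)`, this bounds `t`. -/
theorem exists_eventually_neg_eval_le (hΓ : IsCocompactLattice Γ) {a : H1Class Γ}
    (ha : a ∈ DeltaSet Γ) (p₀ : PSLTilde × PSLTilde) :
    ∃ R : ℝ, ∀ᶠ p in 𝓝 p₀, ∀ γ : Γ,
      (γ : PSLTilde) = p.2 * XOne (-a.eval γ) * p.1⁻¹ → -a.eval γ ≤ R := by
  obtain ⟨c, hc0, hc1, hc⟩ := exists_le_mul_translationLength ha
  obtain ⟨δ, hδ, hne⟩ := exists_absEntry_zero_zero_ne_zero hΓ p₀.1 p₀.2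
  have hθ : Continuous theta := UniversalCover.continuous_proj _
  let m : PSLTilde × PSLTilde → PSL(2, ℝ) := fun p => theta (p.1⁻¹ * δ * p.2)
  let d : PSLTilde × PSLTilde → ℝ := fun p =>
    dist UpperHalfPlane.I (moebius (theta p.2) UpperHalfPlane.I) +
      dist UpperHalfPlane.I (moebius (theta (p.1⁻¹ * δ)) UpperHalfPlane.I)
  have hm : Continuous m := by fun_prop
  have hd : Continuous d :=
    ((continuous_dist_moebius _).comp (by fun_prop : Continuous fun p :
      PSLTilde × PSLTilde => theta p.2)).add
    ((continuous_dist_moebius _).comp (by fun_prop : Continuous fun p :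
      PSLTilde × PSLTilde => theta (p.1⁻¹ * δ)))
  have hpos : 0 < absEntry 0 0 (m p₀) := by
    refine lt_of_le_of_ne ?_ hne.symm
    obtain ⟨A, hA⟩ := QuotientGroup.mk_surjective (m p₀)
    rw [← hA, absEntry_mk]
    exact abs_nonneg _
  set ε := absEntry 0 0 (m p₀) / 2
  set M := absEntry 1 1 (m p₀) + 1
  set D := d p₀ + 1
  have e0 : ∀ᶠ p in 𝓝 p₀, ε < absEntry 0 0 (m p) :=
    ((continuous_absEntry 0 0).comp hm).continuousAt.eventually_const_lt (half_lt_self hpos)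
  have e1 : ∀ᶠ p in 𝓝 p₀, absEntry 1 1 (m p) < M :=
    ((continuous_absEntry 1 1).comp hm).continuousAt.eventually_lt_const (lt_add_one _)
  have e2 : ∀ᶠ p in 𝓝 p₀, d p < D := hd.continuousAt.eventually_lt_const (lt_add_one _)
  let δ' : Γ := ⟨δ, hδ⟩
  refine ⟨max 0 (max (2 * ((2 + M) / ε)) ((c * D + |a.eval δ'|) / (1 - c))), ?_⟩
  filter_upwards [e0, e1, e2] with p h0 h1 h2 γ hγ
  by_contra! hlt
  obtain ⟨ht, hlt⟩ := max_lt_iff.mp hlt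
  obtain ⟨hlt1, hlt2⟩ := max_lt_iff.mp hlt
  set t := -a.eval γ
  have hprod : ((γ * δ' : Γ) : PSLTilde) = p.2 * (XOne t * (p.1⁻¹ * δ * p.2)) * p.2⁻¹ := by
    rw [Subgroup.coe_mul, hγ, show (δ' : PSLTilde) = δ from rfl]; group
  have hprod' : ((γ * δ' : Γ) : PSLTilde) = p.2 * (XOne t * (p.1⁻¹ * δ)) := by
    rw [hprod]; group
  have hLpos : 0 < translationLength ((γ * δ' : Γ) : PSLTilde) := by
    rw [hprod, translationLength_conj]
    exact translationLength_XOne_mul_pos ht.le (half_pos hpos) h0.le h1.le hlt1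
  have hLle : translationLength ((γ * δ' : Γ) : PSLTilde) ≤ t + D := by
    have s1 := translationLength_le ((γ * δ' : Γ) : PSLTilde) UpperHalfPlane.I
    rw [hprod', map_mul theta, map_mul theta] at s1
    have s2 := dist_moebius_mul_le (theta p.2) (theta (XOne t) * theta (p.1⁻¹ * δ))
      UpperHalfPlane.I
    have s3 := dist_moebius_mul_le (theta (XOne t)) (theta (p.1⁻¹ * δ)) UpperHalfPlane.I
    rw [dist_I_XOne, abs_of_pos ht] at s3
    have s4 : dist UpperHalfPlane.I (moebius (theta p.2) UpperHalfPlane.I) +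
      dist UpperHalfPlane.I (moebius (theta (p.1⁻¹ * δ)) UpperHalfPlane.I) < D := h2
    rw [hprod']
    linarith
  have hle := (hc _ hLpos).trans (mul_le_mul_of_nonneg_left hLle hc0)
  rw [H1Class.eval_mul] at hle
  have h3 := neg_abs_le (a.eval γ + a.eval δ')
  have h4 := le_abs_self (a.eval δ')
  have h5 := (div_lt_iff₀ (sub_pos.mpr hc1)).mp hlt2
  nlinarith

theorem exists_neg_eval_le (hΓ : IsCocompactLattice Γ) {a : H1Class Γ} (ha : a ∈ DeltaSet Γ)
    {K K' : Set PSLTilde} (hK : IsCompact K) (hK' : IsCompact K') :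
    ∃ R : ℝ, ∀ k ∈ K, ∀ k' ∈ K', ∀ γ : Γ,
      (γ : PSLTilde) = k' * XOne (-a.eval γ) * k⁻¹ → -a.eval γ ≤ R := by
  suffices h : ∃ R : ℝ, ∀ p ∈ K ×ˢ K', ∀ γ : Γ,
      (γ : PSLTilde) = p.2 * XOne (-a.eval γ) * p.1⁻¹ → -a.eval γ ≤ R by
    obtain ⟨R, hR⟩ := h
    exact ⟨R, fun k hk k' hk' => hR (k, k') (Set.mk_mem_prod hk hk')⟩
  refine (hK.prod hK').induction_on (p := fun s => ∃ R : ℝ, ∀ p ∈ s, ∀ γ : Γ,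
    (γ : PSLTilde) = p.2 * XOne (-a.eval γ) * p.1⁻¹ → -a.eval γ ≤ R) ⟨0, by simp⟩ ?_ ?_ ?_
  · rintro s t hst ⟨R, hR⟩
    exact ⟨R, fun p hp => hR p (hst hp)⟩
  · rintro s t ⟨R, hR⟩ ⟨S, hS⟩
    refine ⟨max R S, fun p hp γ hγ => ?_⟩
    rcases hp with hp | hp
    · exact (hR p hp γ hγ).trans (le_max_left _ _)
    · exact (hS p hp γ hγ).trans (le_max_right _ _)
  · intro p _
    obtain ⟨R, hR⟩ := exists_eventually_neg_eval_le hΓ ha p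
    exact ⟨_, mem_nhdsWithin_of_mem_nhds hR, R, fun q hq => hq⟩

theorem exists_abs_eval_le (hΓ : IsCocompactLattice Γ) {a : H1Class Γ} (ha : a ∈ DeltaSet Γ)
    {K K' : Set PSLTilde} (hK : IsCompact K) (hK' : IsCompact K') :
    ∃ R : ℝ, ∀ k ∈ K, ∀ k' ∈ K', ∀ γ : Γ,
      (γ : PSLTilde) = k' * XOne (-a.eval γ) * k⁻¹ → |a.eval γ| ≤ R := by
  obtain ⟨R, hR⟩ := exists_neg_eval_le hΓ ha hK hK'
  obtain ⟨S, hS⟩ := exists_neg_eval_le hΓ ha hK' hK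
  refine ⟨max R S, fun k hk k' hk' γ hγ => abs_le'.mpr ⟨?_, ?_⟩⟩
  · -- `γ⁻¹ = k X^{a(γ)} k'⁻¹` has the same form, with the compact sets exchanged
    have h := hS k' hk' k hk γ⁻¹ (by
      rw [H1Class.eval_inv, Subgroup.coe_inv, XOne_neg (-a.eval γ)]
      nth_rewrite 1 [hγ]
      group)
    rw [H1Class.eval_inv, neg_neg] at h
    exact h.trans (le_max_right _ _)
  · exact (hR k hk k' hk' γ hγ).trans (le_max_left _ _)

theorem eq_of_twistedAction_eq {a : H1Class Γ} {γ : Γ} {P Q : PSLTilde}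
    (h : (twistedAction a).smul γ P = Q) : (γ : PSLTilde) = Q * XOne (-a.eval γ) * P⁻¹ := by
  have h' : (γ : PSLTilde) * P * XOne (a.eval γ) = Q := h
  rw [XOne_neg, ← h']
  group

theorem isFreeAction_twistedAction {a : H1Class Γ} (ha : a ∈ DeltaSet Γ) :
    IsFreeAction (twistedAction a) := by
  intro γ P h
  have hγ := eq_of_twistedAction_eq h
  obtain ⟨c, -, hc1, hc⟩ := exists_le_mul_translationLength ha
  by_cases h0 : a.eval γ = 0
  · rw [h0, neg_zero, XOne_zero, mul_one, mul_inv_cancel] at hγ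
    exact Subtype.ext hγ
  · exfalso
    have hL : translationLength (γ : PSLTilde) = translationLength (XOne (-a.eval γ)) := by
      nth_rewrite 1 [hγ]
      exact translationLength_conj _ _
    have hpos : 0 < translationLength (γ : PSLTilde) :=
      hL ▸ translationLength_XOne_pos (neg_ne_zero.mpr h0)
    have hle : translationLength (γ : PSLTilde) ≤ |a.eval γ| := by
      rw [hL]
      refine (translationLength_le _ UpperHalfPlane.I).trans_eq ?_
      rw [dist_I_XOne, abs_neg]
    have := hc γ hpos
    nlinarith

theorem isProperlyDiscontinuousAction_twistedAction (hΓ : IsCocompactLattice Γ) {a : H1Class Γ}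
    (ha : a ∈ DeltaSet Γ) : IsProperlyDiscontinuousAction (twistedAction a) := by
  refine @ProperlyDiscontinuousSMul.mk Γ PSLTilde _ (twistedAction a).toSMul ?_
  intro K K' hK hK'
  obtain ⟨R, hR⟩ := exists_abs_eval_le hΓ ha hK hK'
  have hcont : Continuous fun p : PSLTilde × ℝ × PSLTilde => p.1 * XOne p.2.1 * p.2.2⁻¹ := by
    have := continuous_XOne
    fun_prop
  have hcomp := (hK'.prod ((isCompact_Icc (a := -R) (b := R)).prod hK)).image hcont
  refine ((finite_inter_of_discrete hΓ.discrete hcomp).preimage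
    (Subtype.val_injective (p := (· ∈ Γ))).injOn).subset ?_
  rintro γ ⟨_, ⟨k, hk, rfl⟩, hk'⟩
  have hγ := eq_of_twistedAction_eq (a := a) (γ := γ) (P := k) rfl
  have hb := hR k hk _ hk' γ hγ
  refine ⟨γ.2, ⟨_, -a.eval γ, k⟩, ⟨hk', ?_, hk⟩, hγ.symm⟩
  rw [abs_le] at hb
  exact ⟨by simpa using hb.2, by simpa using neg_le.mp hb.1⟩

end

end

theorem proposition3p5 (Γ : Subgroup PSLTilde) (hΓ : IsCocompactLattice Γ)
    (a : H1Class Γ) (ha : a ∈ DeltaSet Γ) :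
    IsFreeAction (twistedAction a) ∧ IsProperlyDiscontinuousAction (twistedAction a) :=
  ⟨isFreeAction_twistedAction ha, isProperlyDiscontinuousAction_twistedAction hΓ ha⟩
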